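/- Let $d\ge 2$ be an integer. For $l\in\mathbb N=\{1,2,\dots\}$, $\mathbb R^l$ carries the Euclidean norm, and we write $\mathbb R^d=\mathbb R^{d-1}\times\mathbb R$. For $L\ge 1$, a map $f$ between subsets of Euclidean spaces is called $L$-bilipschitz if $L^{-1}\|x-y\|\le\|f(x)-f(y)\|\le L\|x-y\|$ for all $x,y$ in its domain. Let $\mathcal F_d$ be the collection of all monotone increasing (i.e. non-decreasing) functions $\psi\colon[1,\infty)\to[1,\infty)$ with the following property: for every $S\in\mathbb N$, with $Q=(-\tfrac12,\dots,-\tfrac12)+[0,S]^{d-1}$, and every permutation $\sigma$ of $\mathbb Z^{d-1}$ which, for each $z\in\mathbb Z^{d-1}$, restricts to a permutation of $\mathbb Z^{d-1}\cap(Q+Sz)$, there is a $\psi(S)$-bilipschitz map $\Upsilon\colon\mathbb R^d\to\mathbb R^d$ with $\Upsilon(p)=p$ for all $p\in\mathbb R^{d-1}\times\left(\mathbb R\setminus(-\tfrac12,\tfrac12)\right)$ and $\Upsilon(x,0)=(\sigma(x),0)$ for all $x\in\mathbb Z^{d-1}$. **Theorem.** There is a monotone increasing (i.e. non-decreasing)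 function $\beta_d\colon[1,\infty)\to[1,\infty)$ such that $2\lfloor t\rfloor-1\le\beta_d(t)\le 2^{8dt}$ for all $t\in[1,\infty)$ and the following holds. Let $T,N\in\mathbb N$, $m\in\mathbb R$, and let $\sigma$ be a permutation of $\frac1N\mathbb Z^{d-1}$ with $\|\sigma(x)-x\|\le T$ for all $x\in\frac1N\mathbb Z^{d-1}$. Then there is an $N\beta_d(6NT)^{3^{d-1}}$-bilipschitz map $$\Upsilon\colon\mathbb R^{d-1}\times[m-\tfrac12,m+\tfrac12]\to\mathbb R^{d-1}\times[m-\tfrac12,m+\tfrac12]$$ such that 1. $\Upsilon(p)=p$ for all $p\in\mathbb R^{d-1}\times\{m-\tfrac12,m+\tfrac12\}$; 2. $\Upsilon(x,m)=(\sigma(x),m)$ for all $x\in\frac1N\mathbb Z^{d-1}$. Moreover, $\beta_d$ may be taken to be the pointwise infimum of $\mathcal F_d$, i.e. $\beta_d(t)=\inf\{\psi(t):\psi\in\mathcal F_d\}$ for all $t\in[1,\infty)$, where $\mathcal F_d\neq\emptyset$. -/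

import Mathlib

/-- `ℝ^{d-1}` with its Euclidean norm. -/
abbrev BaseSpace (d : ℕ) : Type := EuclideanSpace ℝ (Fin (d - 1))

/-- `ℝ^d = ℝ^{d-1} × ℝ` with its Euclidean norm (the `L²` product norm). -/
abbrev FullSpace (d : ℕ) : Type := WithLp 2 (BaseSpace d × ℝ)

/-- The lattice `(1/N) ℤ^{d-1}` inside `ℝ^{d-1}`. -/
def gridLattice (d N : ℕ) : Set (BaseSpace d) :=
  {x | ∀ i, ∃ k : ℤ, x i = (k : ℝ) / (N : ℝ)}

/-- `f` is `L`-bilipschitz: it is injective, and both `f` and its inverse (defined on the image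
of `f`) are `L`-Lipschitz. Injectivity follows from the second inequality. -/
def IsBilipschitz {X Y : Type*} [MetricSpace X] [MetricSpace Y] (L : ℝ) (f : X → Y) : Prop :=
  ∀ x y, dist (f x) (f y) ≤ L * dist x y ∧ dist x y ≤ L * dist (f x) (f y)

/-- The tile `Q + S z`, where `Q = (-1/2, …, -1/2) + [0, S]^{d-1}` and `z ∈ ℤ^{d-1}`. -/
def gridTile (d S : ℕ) (z : Fin (d - 1) → ℤ) : Set (BaseSpace d) :=
  {x | ∀ i, x i ∈ Set.Icc (-(1 / 2) + (S : ℝ) * z i) (-(1 / 2) + (S : ℝ) + (S : ℝ) * z i)}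

/-- The permutation `σ` of `ℤ^{d-1}` restricts, for every `z`, to a permutation of
`ℤ^{d-1} ∩ (Q + S z)`. -/
def RespectsTiles (d S : ℕ) (σ : Equiv.Perm (gridLattice d 1)) : Prop :=
  ∀ z : Fin (d - 1) → ℤ,
    Set.BijOn σ {x : gridLattice d 1 | (x : BaseSpace d) ∈ gridTile d S z}
      {x : gridLattice d 1 | (x : BaseSpace d) ∈ gridTile d S z}

/-- The collection of all monotone functions `ψ : [1, ∞) → [1, ∞)` such that, for all `S ≥ 1`,
every permutation of `ℤ^{d-1}` that respects the tiles of side `S` is realised on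
`ℤ^{d-1} × {0}` by a `ψ(S)`-bilipschitz map of `ℝ^d` that is the identity on
`ℝ^{d-1} × (ℝ ∖ (-1/2, 1/2))`. Only the values of `ψ` on `[1, ∞)` are relevant. -/
def tilePermBounds (d : ℕ) : Set (ℝ → ℝ) :=
  {ψ | MonotoneOn ψ (Set.Ici 1) ∧ (∀ t, 1 ≤ t → 1 ≤ ψ t) ∧
    ∀ S : ℕ, 1 ≤ S → ∀ σ : Equiv.Perm (gridLattice d 1), RespectsTiles d S σ →
      ∃ Υ : FullSpace d → FullSpace d, IsBilipschitz (ψ S) Υ ∧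
        (∀ p : FullSpace d, p.snd ∉ Set.Ioo (-(1 / 2) : ℝ) (1 / 2) → Υ p = p) ∧
        ∀ x : gridLattice d 1,
          Υ (WithLp.toLp 2 ((x : BaseSpace d), (0 : ℝ))) =
            WithLp.toLp 2 ((σ x : BaseSpace d), (0 : ℝ))}

/-- The slab `ℝ^{d-1} × [m - 1/2, m + 1/2]`. -/
def slab (d : ℕ) (m : ℝ) : Set (FullSpace d) :=
  {p | p.snd ∈ Set.Icc (m - 1 / 2) (m + 1 / 2)}

theorem layer_mem_slab (d : ℕ) (m : ℝ) (x : BaseSpace d) :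
    (WithLp.toLp 2 (x, m) : FullSpace d) ∈ slab d m := by
  constructor <;> simp

/-- The point `(x, m)` of the slab `ℝ^{d-1} × [m - 1/2, m + 1/2]`. -/
def layerPoint (d : ℕ) (m : ℝ) (x : BaseSpace d) : slab d m :=
  ⟨WithLp.toLp 2 (x, m), layer_mem_slab d m x⟩

/-! The spare dimension does the work. If `σ` moves each coordinate by at most `R / N`, its
displacements take at most `M = (2 * R + 1) ^ (d - 1)` values. Each value gets its own height in
`[0, 1/4]`. Lift `(x, 0)` to the height of the displacement of `x`, apply a shear that translates
each of these heights by its own displacement, then lower `σ x` back to height `0`. Lattice points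
are `1 / N` apart and the heights are bounded, so all three maps are bilipschitz
(`exists_bilipschitz_realization`).

No decomposition of `σ` into tile permutations is needed. With `N = 1` and `R = S - 1` the
construction puts `2 ^ (8 d t)` into `tilePermBounds d`, so the infimum `β` makes sense and has this
upper bound. Reversing every tile sends two neighbours in adjacent tiles to points at least `2 S -
1` apart, which bounds every `ψ`, hence `β`, from below. So `β (6 N T) ≥ 12 N T - 1`, and this alone
makes `N * β (6 N T) ^ 3 ^ (d - 1)` exceed the constant of the construction with `R = N T`. -/

theorem IsBilipschitz.mono {X Y : Type*} [MetricSpace X] [MetricSpace Y] {L L' : ℝ} {f : X → Y}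
    (hf : IsBilipschitz L f) (h : L ≤ L') : IsBilipschitz L' f := fun x y =>
  ⟨(hf x y).1.trans (by gcongr), (hf x y).2.trans (by gcongr)⟩

theorem IsBilipschitz.injective {X Y : Type*} [MetricSpace X] [MetricSpace Y] {L : ℝ} {f : X → Y}
    (hf : IsBilipschitz L f) : Function.Injective f := fun x y h => by
  have := (hf x y).2
  rw [h, dist_self, mul_zero] at this
  exact dist_le_zero.1 this

theorem IsBilipschitz.comp {X Y Z : Type*} [MetricSpace X] [MetricSpace Y] [MetricSpace Z]
    {L L' : ℝ} {g : Y → Z} {f : X → Y} (hg : IsBilipschitz L g) (hf : IsBilipschitz L' f)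
    (hL : 0 ≤ L) (hL' : 0 ≤ L') : IsBilipschitz (L * L') (g ∘ f) := fun x y => by
  constructor
  · calc dist (g (f x)) (g (f y)) ≤ L * dist (f x) (f y) := (hg _ _).1
      _ ≤ L * (L' * dist x y) := by gcongr; exact (hf _ _).1
      _ = _ := by ring
  · calc dist x y ≤ L' * dist (f x) (f y) := (hf _ _).2
      _ ≤ L' * (L * dist (g (f x)) (g (f y))) := by gcongr; exact (hg _ _).2
      _ = _ := by simp only [Function.comp]; ring

theorem IsBilipschitz.rightInverse {X Y : Type*} [MetricSpace X] [MetricSpace Y] {L : ℝ}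
    {f : X → Y} {g : Y → X} (hf : IsBilipschitz L f) (hg : Function.RightInverse g f) :
    IsBilipschitz L g := fun x y => by
  have := hf (g x) (g y)
  rw [hg, hg] at this
  exact this.symm

/-! ### Vertical lifts and horizontal shears of a product -/

section Product

variable {E : Type*}

/-- The vertical map `(u, t) ↦ (u, t + η u * max 0 (1 - 2 |t|))`. It moves `(u, 0)` to the height
`η u` and fixes all points of height at least `1/2` in absolute value. -/
noncomputable def verticalLift (η : E → ℝ) (p : WithLp 2 (E × ℝ)) : WithLp 2 (E × ℝ) :=
  WithLp.toLp 2 (p.fst, p.snd + η p.fst * max 0 (1 - 2 * |p.snd|))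

theorem verticalLift_of_notMem {η : E → ℝ} {p : WithLp 2 (E × ℝ)}
    (hp : p.snd ∉ Set.Ioo (-(1 / 2) : ℝ) (1 / 2)) : verticalLift η p = p := by
  have h : 1 - 2 * |p.snd| ≤ 0 := by
    by_contra h
    exact hp (abs_lt.1 (by linarith))
  rw [verticalLift, max_eq_left h, mul_zero, add_zero]
  rfl

theorem verticalLift_zero (η : E → ℝ) (u : E) :
    verticalLift η (WithLp.toLp 2 (u, 0)) = WithLp.toLp 2 (u, η u) := by
  simp [verticalLift]

/-- On each vertical line the map is a bounded continuous perturbation of the identity, so the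
intermediate value theorem applies. -/
theorem verticalLift_surjective {η : E → ℝ} (hη' : ∀ u, |η u| ≤ 1 / 4) :
    Function.Surjective (verticalLift η) := fun p => by
  set a := η p.fst with ha
  have hcont : Continuous fun t : ℝ => t + a * max 0 (1 - 2 * |t|) := by fun_prop
  have hbd : ∀ t : ℝ, |a * max 0 (1 - 2 * |t|)| ≤ 1 := fun t => by
    rw [abs_mul, abs_of_nonneg (le_max_left 0 (1 - 2 * |t|))]
    have h1 : max 0 (1 - 2 * |t|) ≤ 1 := max_le zero_le_one (by linarith [abs_nonneg t])
    have := mul_le_mul (hη' p.fst) h1 (le_max_left _ _) (by norm_num)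
    linarith
  have hs : p.snd ∈ Set.range fun t : ℝ => t + a * max 0 (1 - 2 * |t|) := by
    refine mem_range_of_exists_le_of_exists_ge hcont ⟨p.snd - 1, ?_⟩ ⟨p.snd + 1, ?_⟩
    · linarith [(abs_le.1 (hbd (p.snd - 1))).2]
    · linarith [(abs_le.1 (hbd (p.snd + 1))).1]
  obtain ⟨t, ht⟩ := hs
  refine ⟨WithLp.toLp 2 (p.fst, t), ?_⟩
  simp only at ht
  simp only [verticalLift, WithLp.toLp_fst, WithLp.toLp_snd, ← ha, ht]
  rfl

variable [NormedAddCommGroup E]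

theorem dist_fst_le_dist (p q : WithLp 2 (E × ℝ)) : dist p.fst q.fst ≤ dist p q := by
  rw [WithLp.prod_dist_eq_of_L2]
  exact Real.le_sqrt_of_sq_le (by nlinarith [sq_nonneg (dist p.snd q.snd)])

theorem dist_snd_le_dist (p q : WithLp 2 (E × ℝ)) : dist p.snd q.snd ≤ dist p q := by
  rw [WithLp.prod_dist_eq_of_L2]
  exact Real.le_sqrt_of_sq_le (by nlinarith [sq_nonneg (dist p.fst q.fst)])

theorem dist_le_dist_fst_add_dist_snd (p q : WithLp 2 (E × ℝ)) :
    dist p q ≤ dist p.fst q.fst + dist p.snd q.snd := by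
  rw [WithLp.prod_dist_eq_of_L2]
  refine Real.sqrt_le_iff.2 ⟨by positivity, ?_⟩
  nlinarith [mul_nonneg (dist_nonneg (x := p.fst) (y := q.fst))
    (dist_nonneg (x := p.snd) (y := q.snd))]

/-- The horizontal shear `(u, t) ↦ (u + g t, t)`. -/
def horizontalShear (g : ℝ → E) (p : WithLp 2 (E × ℝ)) : WithLp 2 (E × ℝ) :=
  WithLp.toLp 2 (p.fst + g p.snd, p.snd)

/-- The inverse is the shear by `-g`, so the same estimate serves both directions. -/
theorem isBilipschitz_horizontalShear {g : ℝ → E} {K : ℝ} (hK : 0 ≤ K)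
    (hg : ∀ s t, dist (g s) (g t) ≤ K * dist s t) :
    IsBilipschitz (2 + K) (horizontalShear g) := fun p q => by
  have hs := dist_le_dist_fst_add_dist_snd (horizontalShear g p) (horizontalShear g q)
  have h1 := dist_fst_le_dist (horizontalShear g p) (horizontalShear g q)
  have h2 := dist_snd_le_dist (horizontalShear g p) (horizontalShear g q)
  have h3 := dist_fst_le_dist p q
  have h4 := dist_snd_le_dist p q
  have h5 := dist_le_dist_fst_add_dist_snd p q
  have h6 := hg p.snd q.snd
  have h7 := mul_le_mul_of_nonneg_left h4 hK
  have h8 := mul_le_mul_of_nonneg_left h2 hK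
  simp only [horizontalShear, WithLp.toLp_fst, WithLp.toLp_snd] at hs h1 h2 h8 ⊢
  have h9 := dist_add_add_le p.fst (g p.snd) q.fst (g q.snd)
  have h10 := dist_sub_sub_le (p.fst + g p.snd) (g p.snd) (q.fst + g q.snd) (g q.snd)
  rw [add_sub_cancel_right, add_sub_cancel_right] at h10
  constructor <;> nlinarith

theorem abs_max_zero_one_sub_le (s t : ℝ) :
    |max 0 (1 - 2 * |s|) - max 0 (1 - 2 * |t|)| ≤ 2 * |s - t| := by
  refine (abs_max_sub_max_le_max _ _ _ _).trans (max_le (by simp) ?_)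
  have h := abs_abs_sub_abs_le s t
  rw [abs_le] at h ⊢
  constructor <;> linarith

/-- The tent has slope at most `2` and `|η| ≤ 1 / 4`, so along vertical lines the perturbation is
`1/2`-Lipschitz and can be absorbed when inverting. -/
theorem isBilipschitz_verticalLift {η : E → ℝ} {K : ℝ} (hK : 1 ≤ K)
    (hη : ∀ u v, dist (η u) (η v) ≤ K / 4 * dist u v) (hη' : ∀ u, |η u| ≤ 1 / 4) :
    IsBilipschitz (4 * K) (verticalLift η) := fun p q => by
  have hs := dist_le_dist_fst_add_dist_snd (verticalLift η p) (verticalLift η q)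
  have h1 := dist_fst_le_dist (verticalLift η p) (verticalLift η q)
  have h2 := dist_snd_le_dist (verticalLift η p) (verticalLift η q)
  have h3 := dist_fst_le_dist p q
  have h4 := dist_snd_le_dist p q
  have h5 := dist_le_dist_fst_add_dist_snd p q
  have h6 := hη p.fst q.fst
  simp only [verticalLift, WithLp.toLp_fst, WithLp.toLp_snd] at hs h1 h2 ⊢
  set b := max 0 (1 - 2 * |p.snd|) with hb
  set c := max 0 (1 - 2 * |q.snd|) with hc
  set D := dist p.fst q.fst
  have hD : 0 ≤ D := dist_nonneg
  have hbc : |b - c| ≤ 2 * |p.snd - q.snd| := abs_max_zero_one_sub_le _ _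
  have hb0 : |b| ≤ 1 := by
    rw [abs_of_nonneg (le_max_left _ _)]
    exact max_le zero_le_one (by linarith [abs_nonneg p.snd])
  have key : |η p.fst * b - η q.fst * c| ≤ K / 4 * D + 1 / 2 * |p.snd - q.snd| := by
    have e : η p.fst * b - η q.fst * c = (η p.fst - η q.fst) * b + η q.fst * (b - c) := by ring
    rw [e]
    refine (abs_add_le _ _).trans ?_
    rw [abs_mul, abs_mul]
    rw [Real.dist_eq] at h6
    have := mul_le_mul h6 hb0 (abs_nonneg _) (by positivity)
    have := mul_le_mul (hη' q.fst) hbc (abs_nonneg _) (by positivity)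
    linarith
  have hKD : D ≤ K * D := by nlinarith
  rw [Real.dist_eq] at h2 h4 h5 hs
  set t := |p.snd - q.snd| with ht
  have hp0 : 0 ≤ dist p q := dist_nonneg
  have ht0 : 0 ≤ t := abs_nonneg _
  have h7 : |p.snd + η p.fst * b - (q.snd + η q.fst * c)| ≤ K / 4 * D + 3 / 2 * t := by
    have := abs_add_le (p.snd - q.snd) (η p.fst * b - η q.fst * c)
    rw [show p.snd + η p.fst * b - (q.snd + η q.fst * c)
      = (p.snd - q.snd) + (η p.fst * b - η q.fst * c) by ring]
    linarith
  have h8 : t ≤ |p.snd + η p.fst * b - (q.snd + η q.fst * c)| + (K / 4 * D + 1 / 2 * t) := by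
    have := abs_sub (p.snd + η p.fst * b - (q.snd + η q.fst * c)) (η p.fst * b - η q.fst * c)
    rw [show p.snd + η p.fst * b - (q.snd + η q.fst * c) - (η p.fst * b - η q.fst * c)
      = (p.snd - q.snd) by ring] at this
    linarith
  constructor
  · nlinarith
  · nlinarith

end Product

/-! ### Lipschitz extension of discrete data -/

theorem one_div_le_dist_of_ne {d N : ℕ} (hN : 1 ≤ N) {x y : BaseSpace d}
    (hx : x ∈ gridLattice d N) (hy : y ∈ gridLattice d N) (h : x ≠ y) :
    1 / (N : ℝ) ≤ dist x y := by
  obtain ⟨i, hi⟩ : ∃ i, x i ≠ y i := by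
    by_contra! hc
    exact h (PiLp.ext hc)
  obtain ⟨k, hk⟩ := hx i
  obtain ⟨l, hl⟩ := hy i
  have hN' : (0 : ℝ) < N := by exact_mod_cast hN
  have hkl : k ≠ l := fun e => hi (by rw [hk, hl, e])
  have h1 : (1 : ℝ) ≤ |(k : ℝ) - l| := by
    exact_mod_cast Int.one_le_abs (sub_ne_zero.2 hkl)
  calc 1 / (N : ℝ) ≤ |(k : ℝ) - l| / N := by gcongr
    _ = ‖(x - y) i‖ := by
      rw [PiLp.sub_apply, hk, hl, ← sub_div, Real.norm_eq_abs, abs_div, abs_of_pos hN']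
    _ ≤ ‖x - y‖ := PiLp.norm_apply_le _ _
    _ = dist x y := (dist_eq_norm _ _).symm

theorem exists_lipschitz_extension_of_gridLattice {d N : ℕ} (hN : 1 ≤ N)
    (h : gridLattice d N → ℝ) (h0 : ∀ x, h x ∈ Set.Icc (0 : ℝ) (1 / 4)) :
    ∃ η : BaseSpace d → ℝ, (∀ u v, dist (η u) (η v) ≤ (N : ℝ) / 4 * dist u v) ∧
      (∀ u, |η u| ≤ 1 / 4) ∧ ∀ x : gridLattice d N, η x = h x := by
  classical
  have hN' : (0 : ℝ) < N := by exact_mod_cast hN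
  let f : BaseSpace d → ℝ := fun u => if hu : u ∈ gridLattice d N then h ⟨u, hu⟩ else 0
  have hf : ∀ x : gridLattice d N, f x = h x := fun x => dif_pos x.2
  have hL : LipschitzOnWith (Real.toNNReal ((N : ℝ) / 4)) f (gridLattice d N) := by
    refine LipschitzOnWith.of_dist_le_mul fun x hx y hy => ?_
    rw [Real.coe_toNNReal _ (by positivity)]
    rcases eq_or_ne x y with rfl | hxy
    · simp
    have h1 := one_div_le_dist_of_ne hN hx hy hxy
    have h2 := h0 ⟨x, hx⟩
    have h3 := h0 ⟨y, hy⟩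
    rw [← hf] at h2 h3
    calc dist (f x) (f y) ≤ 1 / 4 := by
          rw [Real.dist_eq, abs_le]
          constructor <;> linarith [h2.1, h2.2, h3.1, h3.2]
      _ = (N : ℝ) / 4 * (1 / N) := by field_simp
      _ ≤ _ := by gcongr
  obtain ⟨g, hg, hgf⟩ := hL.extend_real
  -- Clamping to `[0, 1/4]` restores the bound that the extension may lose, at no cost in the
  -- Lipschitz constant.
  have hP : LipschitzWith 1 (fun t : ℝ => (Set.projIcc (0 : ℝ) (1 / 4) (by norm_num) t : ℝ)) :=
    (LipschitzWith.subtype_val _).comp (LipschitzWith.projIcc _) |>.weaken (by simp)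
  have hη := hP.comp hg
  refine ⟨fun u => (Set.projIcc (0 : ℝ) (1 / 4) (by norm_num) (g u) : ℝ), fun u v => ?_,
    fun u => ?_, fun x => ?_⟩
  · have := hη.dist_le_mul u v
    rwa [one_mul, Real.coe_toNNReal _ (by positivity)] at this
  · have := (Set.projIcc (0 : ℝ) (1 / 4) (by norm_num) (g u)).2
    rw [abs_of_nonneg this.1]
    exact this.2
  · have : g x = h x := by rw [← hf, hgf x.2]
    simp only [this, Set.projIcc_of_mem _ (h0 x)]

/-- A path through prescribed vectors at the heights `j / (4 M)`, vanishing outside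
`(-1/2, 1/2)`. -/
theorem exists_lipschitz_interpolation {ι : Type*} [Fintype ι] {M : ℕ} (hM : 1 ≤ M)
    (v : Fin M → ι → ℝ) {r : ℝ} (hr : 0 ≤ r) (hv : ∀ j, ‖v j‖ ≤ r) :
    ∃ g : ℝ → ι → ℝ, (∀ s t, dist (g s) (g t) ≤ 8 * M * r * dist s t) ∧
      (∀ j : Fin M, g ((j : ℝ) / (4 * M)) = v j) ∧
      ∀ t, t ∉ Set.Ioo (-(1 / 2) : ℝ) (1 / 2) → g t = 0 := by
  classical
  have hM' : (1 : ℝ) ≤ M := by exact_mod_cast hM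
  let H : Fin M → ℝ := fun j => (j : ℝ) / (4 * M)
  have hH0 : ∀ j, 0 ≤ H j := fun j => by positivity
  have hH1 : ∀ j, H j ≤ 1 / 4 := fun j => by
    rw [div_le_div_iff₀ (by positivity) (by norm_num)]
    have : (j : ℝ) ≤ M := by exact_mod_cast j.2.le
    linarith
  have hsep : ∀ j k, j ≠ k → 1 ≤ 4 * M * dist (H j) (H k) := fun j k hjk => by
    have h1 : (1 : ℝ) ≤ |(j : ℝ) - k| := by
      have : (1 : ℤ) ≤ |(j : ℤ) - k| :=
        Int.one_le_abs (sub_ne_zero.2 fun e => hjk (Fin.ext (by exact_mod_cast e)))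
      exact_mod_cast this
    rw [Real.dist_eq, ← sub_div, abs_div, abs_of_pos (by positivity : (0 : ℝ) < 4 * M)]
    rwa [mul_div_cancel₀ _ (by positivity)]
  have hinj : Function.Injective H := fun j k e => by
    by_contra hjk
    have := hsep j k hjk
    rw [e, dist_self] at this
    norm_num at this
  -- All heights lie in `[0, 1/4]`, so the default value `0` is the one wanted off `(-1/2, 1/2)`.
  let f : ℝ → ι → ℝ := fun t => if h : ∃ j, H j = t then v h.choose else 0
  have hfH : ∀ j, f (H j) = v j := fun j => by
    have h : ∃ k, H k = H j := ⟨j, rfl⟩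
    simp only [f, dif_pos h]
    rw [hinj h.choose_spec]
  have hf0 : ∀ t, t ∉ Set.Ioo (-(1 / 2) : ℝ) (1 / 2) → f t = 0 := fun t ht => by
    refine dif_neg ?_
    rintro ⟨j, rfl⟩
    exact ht ⟨by linarith [hH0 j], by linarith [hH1 j]⟩
  have hfar : ∀ j t, t ∉ Set.Ioo (-(1 / 2) : ℝ) (1 / 2) →
      dist (v j) 0 ≤ 8 * M * r * dist (H j) t := fun j t ht => by
    have : 1 / 4 ≤ dist (H j) t := by
      rw [Real.dist_eq]
      by_contra hc
      have := abs_lt.1 (not_le.1 hc)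
      exact ht ⟨by linarith [hH0 j], by linarith [hH1 j]⟩
    rw [dist_zero_right]
    have h2 : r ≤ M * r := by nlinarith
    have h3 := mul_le_mul_of_nonneg_left this (by positivity : 0 ≤ 8 * M * r)
    linarith [hv j]
  -- Two prescribed vectors differ by at most `2 r` over a height gap of at least `1 / (4 M)`,
  -- whence `8 M r`.
  have hL : LipschitzOnWith (Real.toNNReal (8 * M * r)) f
      (Set.range H ∪ {t | t ∉ Set.Ioo (-(1 / 2) : ℝ) (1 / 2)}) := by
    refine LipschitzOnWith.of_dist_le_mul fun s hs t ht => ?_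
    rw [Real.coe_toNNReal _ (by positivity)]
    rcases hs with ⟨j, rfl⟩ | hs <;> rcases ht with ⟨k, rfl⟩ | ht
    · rcases eq_or_ne j k with rfl | hjk
      · simp
      rw [hfH, hfH]
      have h1 := hsep j k hjk
      have h2 := dist_triangle_right (v j) (v k) 0
      rw [dist_zero_right, dist_zero_right] at h2
      nlinarith [hv j, hv k]
    · rw [hfH, hf0 t ht]
      exact hfar j t ht
    · rw [hfH, hf0 s hs, dist_comm, dist_comm s]
      exact hfar k s hs
    · rw [hf0 s hs, hf0 t ht, dist_self]
      positivity
  obtain ⟨g, hg, hgf⟩ := hL.extend_pi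
  refine ⟨g, fun s t => ?_, fun j => ?_, fun t ht => ?_⟩
  · have := hg.dist_le_mul s t
    rwa [Real.coe_toNNReal _ (by positivity)] at this
  · rw [← hgf (Or.inl ⟨j, rfl⟩)]
    exact hfH j
  · rw [← hgf (Or.inr ht)]
    exact hf0 t ht

/-! ### Realising a permutation of bounded displacement -/

theorem dist_toLp_le {n : ℕ} (v w : Fin n → ℝ) :
    dist (WithLp.toLp 2 v : EuclideanSpace ℝ (Fin n)) (WithLp.toLp 2 w) ≤ 2 ^ n * dist v w := by
  rw [EuclideanSpace.dist_eq]
  refine Real.sqrt_le_iff.2 ⟨by positivity, ?_⟩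
  calc ∑ i, dist (v i) (w i) ^ 2 ≤ ∑ _i : Fin n, dist v w ^ 2 := by
        gcongr with i
        exact dist_le_pi_dist v w i
    _ = n * dist v w ^ 2 := by simp
    _ ≤ 2 ^ n * 2 ^ n * dist v w ^ 2 := by
        gcongr
        have h1 : (n : ℝ) ≤ 2 ^ n := by exact_mod_cast Nat.lt_two_pow_self.le
        have h2 : (1 : ℝ) ≤ 2 ^ n := one_le_pow₀ (by norm_num)
        nlinarith
    _ = _ := by ring

/-- The bilipschitz constant with which permutations of `(1/N) ℤ^n` with coordinate displacements
at most `R / N` are realised. -/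
def realizationConstant (n N R : ℕ) : ℝ :=
  16 * N ^ 2 * (2 + 2 ^ n * (8 * (2 * R + 1) ^ n * R))

theorem exists_bilipschitz_realization {d N R : ℕ} (hN : 1 ≤ N)
    (σ : Equiv.Perm (gridLattice d N))
    (hσ : ∀ (x : gridLattice d N) i, |(σ x : BaseSpace d) i - (x : BaseSpace d) i| ≤ R / N) :
    ∃ Υ : FullSpace d → FullSpace d, IsBilipschitz (realizationConstant (d - 1) N R) Υ ∧
      (∀ p : FullSpace d, p.snd ∉ Set.Ioo (-(1 / 2) : ℝ) (1 / 2) → Υ p = p) ∧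
      ∀ x : gridLattice d N, Υ (WithLp.toLp 2 ((x : BaseSpace d), (0 : ℝ))) =
        WithLp.toLp 2 ((σ x : BaseSpace d), (0 : ℝ)) := by
  classical
  have hN' : (1 : ℝ) ≤ N := by exact_mod_cast hN
  have hN0 : (0 : ℝ) < N := by linarith
  choose k hk using fun x : gridLattice d N => x.2
  let D : Finset (Fin (d - 1) → ℤ) := Fintype.piFinset fun _ => Finset.Icc (-(R : ℤ)) R
  have hD : D.card = (2 * R + 1) ^ (d - 1) := by
    simp only [D, Fintype.card_piFinset_const, Int.card_Icc]
    congr 1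
    omega
  have hmem : ∀ x, k (σ x) - k x ∈ D := fun x => by
    refine Fintype.mem_piFinset.2 fun i => Finset.mem_Icc.2 (abs_le.1 ?_)
    have := hσ x i
    rw [hk, hk, ← sub_div, abs_div, abs_of_pos hN0, div_le_div_iff_of_pos_right hN0] at this
    rw [Pi.sub_apply, ← Int.cast_le (R := ℝ)]
    push_cast
    exact this
  set M := (2 * R + 1) ^ (d - 1) with hMdef
  have hM : 1 ≤ M := Nat.one_le_pow _ _ (by omega)
  have hM' : (1 : ℝ) ≤ M := by exact_mod_cast hM
  let e : D ≃ Fin M := D.equivFinOfCardEq hD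
  let v : Fin M → Fin (d - 1) → ℝ := fun j i => ((e.symm j : Fin (d - 1) → ℤ) i : ℝ) / N
  have hv : ∀ j, ‖v j‖ ≤ R := fun j => by
    refine (pi_norm_le_iff_of_nonneg (by positivity)).2 fun i => ?_
    have h1 := abs_le.2 (Finset.mem_Icc.1 (Fintype.mem_piFinset.1 (e.symm j).2 i))
    have h2 : |((e.symm j : Fin (d - 1) → ℤ) i : ℝ)| ≤ R := by exact_mod_cast h1
    rw [Real.norm_eq_abs, abs_div, abs_of_pos hN0]
    exact (div_le_self (abs_nonneg _) hN').trans h2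
  obtain ⟨g, hg, hgv, hg0⟩ := exists_lipschitz_interpolation hM v (Nat.cast_nonneg R) hv
  let c : gridLattice d N → Fin M := fun x => e ⟨_, hmem x⟩
  let h : gridLattice d N → ℝ := fun x => (c x : ℝ) / (4 * M)
  have hh : ∀ x, h x ∈ Set.Icc (0 : ℝ) (1 / 4) := fun x => by
    refine ⟨by positivity, ?_⟩
    rw [div_le_div_iff₀ (by positivity) (by norm_num)]
    have : (c x : ℝ) ≤ M := by exact_mod_cast (c x).2.le
    linarith
  obtain ⟨η, hη1, hη2, hη3⟩ := exists_lipschitz_extension_of_gridLattice hN h hh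
  -- `θ` at `σ x` is the height assigned to `x`, so inverting its lift brings the sheared point back
  -- to height `0`.
  obtain ⟨θ, hθ1, hθ2, hθ3⟩ := exists_lipschitz_extension_of_gridLattice hN
    (fun x => h (σ.symm x)) fun x => hh _
  let G : ℝ → BaseSpace d := fun t => WithLp.toLp 2 (g t)
  have hG : ∀ s t, dist (G s) (G t) ≤ 2 ^ (d - 1) * (8 * M * R) * dist s t := fun s t => by
    refine (dist_toLp_le _ _).trans ?_
    rw [mul_assoc]
    gcongr
    exact hg s t
  have bη := isBilipschitz_verticalLift hN' hη1 hη2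
  have bθ := isBilipschitz_verticalLift hN' hθ1 hθ2
  have bG := isBilipschitz_horizontalShear (by positivity) hG
  obtain ⟨W, hW⟩ := (verticalLift_surjective hθ2).hasRightInverse
  have hW' : Function.LeftInverse W (verticalLift θ) :=
    hW.leftInverse_of_injective bθ.injective
  refine ⟨W ∘ horizontalShear G ∘ verticalLift η, ?_, fun p hp => ?_, fun x => ?_⟩
  · refine ((bθ.rightInverse hW).comp (bG.comp bη (by positivity) (by positivity))
      (by positivity) (by positivity)).mono (le_of_eq ?_)
    rw [realizationConstant, hMdef]
    push_cast
    ring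
  · have h1 : horizontalShear G p = p := by
      rw [horizontalShear]
      simp only [G, hg0 _ hp, WithLp.toLp_zero, add_zero]
      rfl
    simp only [Function.comp, verticalLift_of_notMem hp, h1]
    conv_lhs => rw [← verticalLift_of_notMem (η := θ) hp]
    exact hW' p
  · have h1 : (x : BaseSpace d) + G (h x) = σ x := by
      refine PiLp.ext fun i => ?_
      have : g (h x) = v (c x) := hgv (c x)
      simp only [PiLp.add_apply, G, this, v, c, Equiv.symm_apply_apply, hk, Pi.sub_apply,
        Int.cast_sub]
      ring
    have h2 : θ (σ x) = h x := by rw [hθ3, Equiv.symm_apply_apply]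
    simp only [Function.comp, verticalLift_zero, hη3, horizontalShear, WithLp.toLp_fst, WithLp.toLp_snd]
    rw [h1, ← h2, ← verticalLift_zero]
    exact hW' _

/-! ### Numerical bounds on the constant -/

theorem realizationConstant_le_two_pow (n R : ℕ) :
    realizationConstant n 1 R ≤ (2 : ℝ) ^ (8 * (n + 1) * (R + 1)) := by
  have h1 : 2 * R + 1 ≤ 2 ^ (R + 1) := by
    induction R with
    | zero => norm_num
    | succ R ih =>
      have : 2 ≤ 2 ^ (R + 1) := Nat.le_self_pow (by omega) 2
      rw [pow_succ]
      omega
  have h2 : R ≤ 2 ^ R := Nat.lt_two_pow_self.le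
  have h3 : (2 * R + 1) ^ n ≤ 2 ^ ((R + 1) * n) := by
    rw [pow_mul]
    exact Nat.pow_le_pow_left h1 n
  have key : 16 * 1 ^ 2 * (2 + 2 ^ n * (8 * (2 * R + 1) ^ n * R)) ≤ 2 ^ (8 * (n + 1) * (R + 1)) := by
    have h4 : 2 ^ n * (8 * (2 * R + 1) ^ n * R) ≤ 8 * 2 ^ (n + (R + 1) * n + R) := by
      calc 2 ^ n * (8 * (2 * R + 1) ^ n * R) ≤ 2 ^ n * (8 * 2 ^ ((R + 1) * n) * 2 ^ R) := by gcongr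
        _ = _ := by ring
    have h5 : 1 ≤ 2 ^ (n + (R + 1) * n + R) := Nat.one_le_two_pow
    calc 16 * 1 ^ 2 * (2 + 2 ^ n * (8 * (2 * R + 1) ^ n * R))
        ≤ 2 ^ 8 * 2 ^ (n + (R + 1) * n + R) := by omega
      _ = 2 ^ (8 + (n + (R + 1) * n + R)) := (pow_add _ _ _).symm
      _ ≤ _ := Nat.pow_le_pow_right (by norm_num) (by nlinarith [Nat.zero_le (n * R)])
  rw [realizationConstant]
  exact_mod_cast key

/-- Since `R ≥ 1`, `b ≥ 11 R`; since `N ≤ R`, the constant is at most `160 N 6 ^ n R ^ (n + 2)`. Of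
the exponent `3 ^ n` only `n + 2 ≤ 3 ^ n` is used. -/
theorem realizationConstant_le_mul_pow {n N R : ℕ} (hn : 1 ≤ n) (hN : 1 ≤ N) (hNR : N ≤ R) {b : ℝ}
    (hb : 12 * (R : ℝ) - 1 ≤ b) : realizationConstant n N R ≤ N * b ^ (3 ^ n) := by
  have hN' : (1 : ℝ) ≤ N := by exact_mod_cast hN
  have hNR' : (N : ℝ) ≤ R := by exact_mod_cast hNR
  have hR : (1 : ℝ) ≤ R := hN'.trans hNR'
  have hexp : n + 2 ≤ 3 ^ n := by
    clear hb
    induction n, hn using Nat.le_induction with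
    | base => norm_num
    | succ n _ ih => rw [pow_succ]; omega
  have hnum : 160 * (6 : ℝ) ^ n ≤ 11 ^ (n + 2) := by
    clear hexp
    induction n, hn using Nat.le_induction with
    | base => norm_num
    | succ n _ ih =>
      rw [pow_succ, show n + 1 + 2 = (n + 2) + 1 by ring, pow_succ (11 : ℝ)]
      nlinarith [pow_pos (by norm_num : (0 : ℝ) < 11) (n + 2)]
  have h1 : (11 * (R : ℝ)) ^ (n + 2) ≤ b ^ (3 ^ n) :=
    (pow_le_pow_left₀ (by positivity) (by linarith) _).trans
      (pow_le_pow_right₀ (by linarith) hexp)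
  have h2 : (2 * (R : ℝ) + 1) ^ n ≤ 3 ^ n * R ^ n := by
    rw [← mul_pow]
    exact pow_le_pow_left₀ (by positivity) (by linarith) _
  have h6 : (6 : ℝ) ^ n = 2 ^ n * 3 ^ n := by rw [← mul_pow]; norm_num
  have h3 : (1 : ℝ) ≤ 6 ^ n * R ^ (n + 1) :=
    one_le_mul_of_one_le_of_one_le (one_le_pow₀ (by norm_num)) (one_le_pow₀ hR)
  calc realizationConstant n N R
      ≤ 16 * (N * R) * (2 * (6 ^ n * R ^ (n + 1)) + 2 ^ n * (8 * (3 ^ n * R ^ n) * R)) := by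
        rw [realizationConstant, sq]
        gcongr
        linarith
    _ = N * (160 * 6 ^ n * R ^ (n + 2)) := by rw [h6]; ring
    _ ≤ N * (11 ^ (n + 2) * R ^ (n + 2)) := by gcongr
    _ = N * (11 * R) ^ (n + 2) := by rw [mul_pow]
    _ ≤ _ := by gcongr

/-! ### Lower bound: reversing the tiles -/

/-- The reversal of each block `{S q, …, S q + S - 1}` of integers. -/
def blockReverse (S : ℕ) (k : ℤ) : ℤ := S - 1 - k + 2 * (S * (k / S))

theorem blockReverse_of_mem {S : ℕ} (hS : 1 ≤ S) {k q : ℤ} (h1 : S * q ≤ k)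
    (h2 : k < S * q + S) : blockReverse S k = S - 1 - k + 2 * (S * q) := by
  have hS' : (0 : ℤ) < S := by exact_mod_cast hS
  have : k / S = q := by
    rw [Int.ediv_eq_iff_of_pos hS']
    constructor <;> linarith [mul_comm (S : ℤ) q]
  rw [blockReverse, this]

theorem blockReverse_mem {S : ℕ} (hS : 1 ≤ S) {k q : ℤ} (h1 : S * q ≤ k)
    (h2 : k < S * q + S) : S * q ≤ blockReverse S k ∧ blockReverse S k < S * q + S := by
  rw [blockReverse_of_mem hS h1 h2]
  constructor <;> linarith

theorem blockReverse_involutive {S : ℕ} (hS : 1 ≤ S) : Function.Involutive (blockReverse S) := by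
  intro k
  have hS' : (0 : ℤ) < S := by exact_mod_cast hS
  have h1 : S * (k / S) ≤ k := Int.mul_ediv_self_le hS'.ne'
  have h2 : k < S * (k / S) + S := Int.lt_mul_ediv_self_add hS'
  have h3 := blockReverse_mem hS h1 h2
  rw [blockReverse_of_mem hS h3.1 h3.2, blockReverse_of_mem hS h1 h2]
  ring

theorem floor_cast_of_mem_gridLattice {d : ℕ} {x : BaseSpace d} (hx : x ∈ gridLattice d 1)
    (i : Fin (d - 1)) : ((⌊x i⌋ : ℤ) : ℝ) = x i := by
  obtain ⟨k, hk⟩ := hx i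
  rw [hk]
  simp

/-- The permutation of `ℤ^{d-1}` that reverses every tile of side `S` in all coordinates. -/
noncomputable def tileReverse (d S : ℕ) (hS : 1 ≤ S) : Equiv.Perm (gridLattice d 1) :=
  Function.Involutive.toPerm
    (fun x => ⟨WithLp.toLp 2 fun i => (blockReverse S ⌊(x : BaseSpace d) i⌋ : ℝ),
      fun i => ⟨blockReverse S ⌊(x : BaseSpace d) i⌋, by simp⟩⟩)
    fun x => Subtype.ext <| PiLp.ext fun i => by
      simp only [Int.floor_intCast, blockReverse_involutive hS _]
      exact floor_cast_of_mem_gridLattice x.2 i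

theorem tileReverse_apply {d S : ℕ} (hS : 1 ≤ S) (x : gridLattice d 1) (i : Fin (d - 1)) :
    (tileReverse d S hS x : BaseSpace d) i = blockReverse S ⌊(x : BaseSpace d) i⌋ := rfl

/-- The endpoints are half-integers, so on integers the closed tiles act as disjoint half-open
blocks. -/
theorem intCast_mem_tile_iff {S : ℕ} {k z : ℤ} :
    (k : ℝ) ∈ Set.Icc (-(1 / 2) + (S : ℝ) * z) (-(1 / 2) + (S : ℝ) + (S : ℝ) * z) ↔
      S * z ≤ k ∧ k < S * z + S := by
  constructor
  · rintro ⟨h1, h2⟩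
    constructor
    · have : ((S * z : ℤ) : ℝ) < (k + 1 : ℤ) := by push_cast; linarith
      have := Int.cast_lt.1 this
      omega
    · have : (k : ℝ) < (S * z + S : ℤ) := by push_cast; linarith
      exact Int.cast_lt.1 this
  · rintro ⟨h1, h2⟩
    have h1' : ((S * z : ℤ) : ℝ) ≤ k := Int.cast_le.2 h1
    have h2' : ((k + 1 : ℤ) : ℝ) ≤ (S * z + S : ℤ) := Int.cast_le.2 h2
    push_cast at h1' h2'
    constructor <;> linarith

theorem respectsTiles_tileReverse {d S : ℕ} (hS : 1 ≤ S) :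
    RespectsTiles d S (tileReverse d S hS) := by
  intro z
  have hmaps : Set.MapsTo (tileReverse d S hS)
      {x : gridLattice d 1 | (x : BaseSpace d) ∈ gridTile d S z}
      {x : gridLattice d 1 | (x : BaseSpace d) ∈ gridTile d S z} := fun x hx i => by
    have h := hx i
    rw [← floor_cast_of_mem_gridLattice x.2 i, intCast_mem_tile_iff] at h
    rw [tileReverse_apply, intCast_mem_tile_iff]
    exact blockReverse_mem hS h.1 h.2
  refine ⟨hmaps, (tileReverse d S hS).injective.injOn, fun x hx => ?_⟩
  exact ⟨tileReverse d S hS x, hmaps hx, (tileReverse d S hS).left_inv x⟩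

/-- The neighbours `0` and `-1` on one axis lie in different tiles; reversal sends these coordinates
to `S - 1` and `-S`. -/
theorem two_mul_sub_one_le_of_mem_tilePermBounds {d S : ℕ} (hd : 2 ≤ d) (hS : 1 ≤ S)
    {ψ : ℝ → ℝ} (hψ : ψ ∈ tilePermBounds d) : 2 * (S : ℝ) - 1 ≤ ψ S := by
  obtain ⟨Υ, hΥ, -, hσ⟩ := hψ.2.2 S hS _ (respectsTiles_tileReverse (d := d) hS)
  have hS' : (1 : ℤ) ≤ S := by exact_mod_cast hS
  let i₀ : Fin (d - 1) := ⟨0, by omega⟩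
  let x : gridLattice d 1 := ⟨0, fun i => ⟨0, by simp⟩⟩
  let y : gridLattice d 1 := ⟨EuclideanSpace.single i₀ (-1), fun i =>
    ⟨if i = i₀ then -1 else 0, by
      rw [PiLp.single_apply]
      split_ifs <;> simp⟩⟩
  have hxy : dist (x : BaseSpace d) y = 1 := by
    rw [dist_eq_norm, zero_sub, norm_neg, PiLp.norm_single]
    norm_num
  have hx : (tileReverse d S hS x : BaseSpace d) i₀ = S - 1 := by
    rw [tileReverse_apply]
    have : ⌊(x : BaseSpace d) i₀⌋ = 0 := by simp [x]
    rw [this, blockReverse_of_mem (q := 0) hS (by omega) (by omega)]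
    push_cast
    ring
  have hy : (tileReverse d S hS y : BaseSpace d) i₀ = -S := by
    rw [tileReverse_apply]
    have : ⌊(y : BaseSpace d) i₀⌋ = -1 := by
      simp only [y, PiLp.single_apply, if_true]
      exact_mod_cast Int.floor_intCast (-1)
    rw [this, blockReverse_of_mem (q := -1) hS (by omega) (by omega)]
    push_cast
    ring
  have h := (hΥ (WithLp.toLp 2 ((x : BaseSpace d), (0 : ℝ)))
    (WithLp.toLp 2 ((y : BaseSpace d), (0 : ℝ)))).1
  rw [hσ, hσ, WithLp.dist_toLp_fst, WithLp.dist_toLp_fst, hxy, mul_one] at h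
  refine le_trans ?_ h
  rw [dist_eq_norm]
  refine le_trans ?_ (PiLp.norm_apply_le _ i₀)
  rw [PiLp.sub_apply, hx, hy]
  exact le_trans (by linarith) (le_abs_self _)

theorem floor_bound_of_mem_tilePermBounds {d : ℕ} (hd : 2 ≤ d) {ψ : ℝ → ℝ}
    (hψ : ψ ∈ tilePermBounds d) {t : ℝ} (ht : 1 ≤ t) : 2 * (⌊t⌋ : ℝ) - 1 ≤ ψ t := by
  have h1 : 1 ≤ ⌊t⌋₊ := (Nat.one_le_floor_iff t).2 ht
  have h2 : (⌊t⌋ : ℝ) = (⌊t⌋₊ : ℝ) := (natCast_floor_eq_intCast_floor (by linarith)).symm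
  rw [h2]
  exact (two_mul_sub_one_le_of_mem_tilePermBounds hd h1 hψ).trans
    (hψ.1 (by simpa using h1) ht (Nat.floor_le (by linarith)))

/-! ### Upper bound: the exponential function is admissible -/

theorem abs_sub_le_of_respectsTiles {d S : ℕ} (hS : 1 ≤ S) {σ : Equiv.Perm (gridLattice d 1)}
    (hσ : RespectsTiles d S σ) (x : gridLattice d 1) (i : Fin (d - 1)) :
    |(σ x : BaseSpace d) i - (x : BaseSpace d) i| ≤ (S : ℝ) - 1 := by
  have hS' : (0 : ℤ) < S := by exact_mod_cast hS
  have hx : (x : BaseSpace d) ∈ gridTile d S fun j => ⌊(x : BaseSpace d) j⌋ / S := fun j => by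
    rw [← floor_cast_of_mem_gridLattice x.2 j, intCast_mem_tile_iff]
    exact ⟨Int.mul_ediv_self_le hS'.ne', Int.lt_mul_ediv_self_add hS'⟩
  have h1 := (hσ _).mapsTo hx i
  have h2 := hx i
  rw [← floor_cast_of_mem_gridLattice x.2 i, ← floor_cast_of_mem_gridLattice (σ x).2 i]
  rw [← floor_cast_of_mem_gridLattice x.2 i, intCast_mem_tile_iff] at h2
  rw [← floor_cast_of_mem_gridLattice (σ x).2 i, intCast_mem_tile_iff] at h1
  have : |⌊(σ x : BaseSpace d) i⌋ - ⌊(x : BaseSpace d) i⌋| ≤ (S : ℤ) - 1 := by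
    simp only at h2
    rw [abs_le]
    constructor <;> linarith [h1.1, h1.2, h2.1, h2.2]
  have := (Int.cast_le (R := ℝ)).2 this
  push_cast at this
  exact this

theorem two_rpow_mem_tilePermBounds {d : ℕ} (hd : 2 ≤ d) :
    (fun t : ℝ => (2 : ℝ) ^ (8 * (d : ℝ) * t)) ∈ tilePermBounds d := by
  refine ⟨fun s _ t _ hst => ?_, fun t ht => ?_, fun S hS σ hσ => ?_⟩
  · exact Real.rpow_le_rpow_of_exponent_le (by norm_num) (by gcongr)
  · exact Real.one_le_rpow (by norm_num) (by positivity)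
  · obtain ⟨R, rfl⟩ : ∃ R, S = R + 1 := ⟨S - 1, by omega⟩
    obtain ⟨Υ, hΥ, h1, h2⟩ := exists_bilipschitz_realization (R := R) le_rfl σ fun x i => by
      simpa using abs_sub_le_of_respectsTiles hS hσ x i
    refine ⟨Υ, hΥ.mono ((realizationConstant_le_two_pow _ _).trans (le_of_eq ?_)), h1, h2⟩
    rw [← Real.rpow_natCast]
    congr 1
    rw [show d - 1 + 1 = d by omega]
    push_cast
    ring

/-! ### Passage to the slab and conclusion -/

/-- Translation by `m` in the vertical direction. -/
def verticalTranslation (d : ℕ) (m : ℝ) (p : FullSpace d) : FullSpace d :=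
  WithLp.toLp 2 (p.fst, p.snd + m)

theorem dist_verticalTranslation (d : ℕ) (m : ℝ) (p q : FullSpace d) :
    dist (verticalTranslation d m p) (verticalTranslation d m q) = dist p q := by
  simp [verticalTranslation, WithLp.prod_dist_eq_of_L2]

/-- A bilipschitz map that is the identity off the open slab around height `0` induces a
bilipschitz self-map of the closed slab around height `m`. -/
theorem exists_slab_map {d : ℕ} (m : ℝ) {L : ℝ} {Υ : FullSpace d → FullSpace d}
    (hΥ : IsBilipschitz L Υ)
    (hid : ∀ p : FullSpace d, p.snd ∉ Set.Ioo (-(1 / 2) : ℝ) (1 / 2) → Υ p = p) :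
    ∃ Φ : slab d m → slab d m, IsBilipschitz L Φ ∧
      ∀ p, (Φ p : FullSpace d) =
        verticalTranslation d m (Υ (verticalTranslation d (-m) p)) := by
  -- If `Υ q` left the slab it would be a fixed point, so injectivity would give `Υ q = q`, which
  -- lies in the slab.
  have hmaps : ∀ q : FullSpace d, q.snd ∈ Set.Icc (-(1 / 2) : ℝ) (1 / 2) →
      (Υ q).snd ∈ Set.Icc (-(1 / 2) : ℝ) (1 / 2) := fun q hq => by
    by_contra hc
    have h := hΥ.injective (hid _ fun h => hc (Set.Ioo_subset_Icc_self h))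
    rw [h] at hc
    exact hc hq
  refine ⟨fun p => ⟨verticalTranslation d m (Υ (verticalTranslation d (-m) p)), ?_⟩,
    fun p q => ?_, fun p => rfl⟩
  · have h := hmaps (verticalTranslation d (-m) p)
      ⟨by simp only [verticalTranslation, WithLp.toLp_snd]; linarith [p.2.1],
        by simp only [verticalTranslation, WithLp.toLp_snd]; linarith [p.2.2]⟩
    exact ⟨by simp only [verticalTranslation, WithLp.toLp_snd] at h ⊢; linarith [h.1],
      by simp only [verticalTranslation, WithLp.toLp_snd] at h ⊢; linarith [h.2]⟩
  · have h := hΥ (verticalTranslation d (-m) p) (verticalTranslation d (-m) q)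
    simpa only [Subtype.dist_eq, dist_verticalTranslation] using h

theorem mainTheorem4 (d : ℕ) (hd : 2 ≤ d) :
    ∃ β : ℝ → ℝ,
      MonotoneOn β (Set.Ici 1) ∧
      (∀ t, 1 ≤ t → 1 ≤ β t) ∧
      (∀ t, 1 ≤ t → 2 * (⌊t⌋ : ℝ) - 1 ≤ β t ∧ β t ≤ (2 : ℝ) ^ (8 * (d : ℝ) * t)) ∧
      (∀ (T N : ℕ), 1 ≤ T → 1 ≤ N → ∀ (m : ℝ) (σ : Equiv.Perm (gridLattice d N)),
        (∀ x : gridLattice d N, ‖(σ x : BaseSpace d) - (x : BaseSpace d)‖ ≤ (T : ℝ)) →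
        ∃ Υ : slab d m → slab d m,
          IsBilipschitz ((N : ℝ) * β (6 * (N : ℝ) * (T : ℝ)) ^ (3 ^ (d - 1))) Υ ∧
          (∀ p : slab d m,
            (p : FullSpace d).snd = m - 1 / 2 ∨ (p : FullSpace d).snd = m + 1 / 2 → Υ p = p) ∧
          ∀ x : gridLattice d N, Υ (layerPoint d m x) = layerPoint d m (σ x)) ∧
      (∀ t, 1 ≤ t → IsGLB {r : ℝ | ∃ ψ ∈ tilePermBounds d, r = ψ t} (β t)) := by
  have hne : ∀ t, {r : ℝ | ∃ ψ ∈ tilePermBounds d, r = ψ t}.Nonempty := fun t =>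
    ⟨_, _, two_rpow_mem_tilePermBounds hd, rfl⟩
  have hglb : ∀ t, 1 ≤ t → IsGLB {r : ℝ | ∃ ψ ∈ tilePermBounds d, r = ψ t}
      (sInf {r : ℝ | ∃ ψ ∈ tilePermBounds d, r = ψ t}) := fun t ht => by
    refine isGLB_csInf (hne t) ⟨1, ?_⟩
    rintro _ ⟨ψ, hψ, rfl⟩
    exact hψ.2.1 t ht
  have hfloor : ∀ t, 1 ≤ t →
      2 * (⌊t⌋ : ℝ) - 1 ≤ sInf {r : ℝ | ∃ ψ ∈ tilePermBounds d, r = ψ t} := fun t ht => by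
    refine (le_isGLB_iff (hglb t ht)).2 ?_
    rintro _ ⟨ψ, hψ, rfl⟩
    exact floor_bound_of_mem_tilePermBounds hd hψ ht
  refine ⟨fun t => sInf {r : ℝ | ∃ ψ ∈ tilePermBounds d, r = ψ t}, ?_, ?_, ?_, ?_, hglb⟩
  · intro s hs t ht hst
    refine (le_isGLB_iff (hglb t ht)).2 ?_
    rintro _ ⟨ψ, hψ, rfl⟩
    exact ((hglb s hs).1 ⟨ψ, hψ, rfl⟩).trans (hψ.1 hs ht hst)
  · intro t ht
    refine (le_isGLB_iff (hglb t ht)).2 ?_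
    rintro _ ⟨ψ, hψ, rfl⟩
    exact hψ.2.1 t ht
  · exact fun t ht => ⟨hfloor t ht, (hglb t ht).1 ⟨_, two_rpow_mem_tilePermBounds hd, rfl⟩⟩
  · intro T N hT hN m σ hσ
    have hN' : (1 : ℝ) ≤ N := by exact_mod_cast hN
    have hT' : (1 : ℝ) ≤ T := by exact_mod_cast hT
    obtain ⟨Υ, hΥ, hid, hlat⟩ := exists_bilipschitz_realization (R := N * T) hN σ fun x i => by
      have h := (PiLp.norm_apply_le ((σ x : BaseSpace d) - (x : BaseSpace d)) i).trans (hσ x)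
      rw [Nat.cast_mul, mul_div_cancel_left₀ _ (by positivity)]
      exact h
    obtain ⟨Φ, hΦ, hΦΥ⟩ := exists_slab_map m hΥ hid
    refine ⟨Φ, hΦ.mono (realizationConstant_le_mul_pow (by omega) hN
      (Nat.le_mul_of_pos_right N hT) ?_), fun p hp => Subtype.ext ?_, fun x => Subtype.ext ?_⟩
    · have h := hfloor (6 * N * T) (by nlinarith)
      have e : ⌊(6 * N * T : ℝ)⌋ = (6 * N * T : ℤ) := by
        exact_mod_cast Int.floor_intCast (R := ℝ) (6 * N * T)
      rw [e] at h
      push_cast at h ⊢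
      linarith
    · rw [hΦΥ, hid]
      · simp only [verticalTranslation, WithLp.toLp_fst, WithLp.toLp_snd, neg_add_cancel_right]
        rfl
      · simp only [verticalTranslation, WithLp.toLp_snd]
        rintro ⟨h1, h2⟩
        rcases hp with hp | hp <;> linarith
    · rw [hΦΥ]
      have : verticalTranslation d (-m) (layerPoint d m x) = WithLp.toLp 2 ((x : BaseSpace d), 0) := by
        simp [verticalTranslation, layerPoint]
      rw [this, hlat]
      simp [verticalTranslation, layerPoint]
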